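/- Let $\mathbb K$ be $\mathbb R$ or $\mathbb C$, and let $X$ be either $\ell_p=\ell_p(\mathbb Z_+)$ with $1\le p<\infty$ or $c_0=c_0(\mathbb Z_+)$, over $\mathbb K$, with canonical basis $(e_n)_{n\ge 0}$. Let $(w_n)_{n\ge 1}$ be a bounded sequence of non-zero elements of $\mathbb K$, and let $T$ be the backward weighted shift on $X$ with weights $w_n$, that is, the bounded linear operator on $X$ with $Te_0=0$ and $Te_n=w_ne_{n-1}$ for $n\ge 1$. Assume that $$\liminf_{n\to\infty}\Bigl(n!\prod_{j=1}^n|w_j|\Bigr)^{1/n}>0,$$ where the value $+\infty$ of the lower limit is allowed. Then $I+T$ satisfies the Kitai Criterion: there exist dense subsets $E$ and $F$ of $X$ and a map $S:F\to F$ such that $(I+T)Sy=y$ and $S^ky\to 0$ as $k\to\infty$ for every $y\in F$, and $(I+T)^kx\to 0$ as $k\to\infty$ for every $x\in E$. -/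

import Mathlib

open Filter Topology
open scoped ENNReal ZeroAtInfty

/-- The Kitai Criterion for a bounded linear operator `T`: there are dense subsets `E` and `F` of
`X` and a (not necessarily linear or continuous) map `S : F → F` with `T (S y) = y` and `S ^ k y → 0`
for `y ∈ F`, and `T ^ k x → 0` for `x ∈ E`. -/
def KitaiCriterion {𝕜 X : Type*} [RCLike 𝕜] [NormedAddCommGroup X] [NormedSpace 𝕜 X]
    (T : X →L[𝕜] X) : Prop :=
  ∃ (E F : Set X) (S : F → F), Dense E ∧ Dense F ∧
    (∀ y : F, T (S y : X) = y) ∧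
    (∀ y : F, Tendsto (fun k : ℕ => ((S^[k] y : F) : X)) atTop (𝓝 0)) ∧
    (∀ x ∈ E, Tendsto (fun k : ℕ => (T ^ k) x) atTop (𝓝 0))

/-- `T` is the backward weighted shift with weights `w 1, w 2, …` (a bounded sequence of nonzero
scalars) with respect to the canonical basis `e 0, e 1, …`. The value `w 0` is not used. -/
structure IsBackwardWeightedShift {𝕜 X : Type*} [RCLike 𝕜] [NormedAddCommGroup X]
    [NormedSpace 𝕜 X] (e : ℕ → X) (w : ℕ → 𝕜) (T : X →L[𝕜] X) : Prop where
  weight_ne_zero : ∀ n, 1 ≤ n → w n ≠ 0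
  weight_bounded : ∃ C : ℝ, ∀ n, 1 ≤ n → ‖w n‖ ≤ C
  map_zero : T (e 0) = 0
  map_basis : ∀ n, 1 ≤ n → T (e n) = w n • e (n - 1)

/-- The `n`-th canonical basis vector of `ℓ_p`, indexed by the non-negative integers. -/
noncomputable def lpBasis (𝕜 : Type*) [RCLike 𝕜] (p : ℝ≥0∞) (n : ℕ) : lp (fun _ : ℕ => 𝕜) p :=
  lp.single p n (1 : 𝕜)

/-- The `n`-th canonical basis vector of `c_0`, which is realised as the space `C₀(ℕ, 𝕜)` of
functions on the discrete space `ℕ` tending to zero at infinity, with the sup norm. -/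
noncomputable def c0Basis (𝕜 : Type*) [RCLike 𝕜] (n : ℕ) : C₀(ℕ, 𝕜) where
  toFun := Pi.single n (1 : 𝕜)
  continuous_toFun := continuous_of_discreteTopology
  zero_at_infty' := by
    rw [cocompact_eq_cofinite, Nat.cofinite_eq_atTop]
    refine tendsto_const_nhds.congr' ?_
    filter_upwards [eventually_gt_atTop n] with m hm
    simp [hm.ne']

/-!
Put `f n = (w 1 ⋯ w n)⁻¹ • e n`, so that `T (f (n + 1)) = f n` and `T (f 0) = 0`; the liminf
condition bounds `‖f n‖` by a multiple of `n! / δⁿ`. For small `c > 0` the series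
`J g = ∑ (Vⁿ⁺¹ g)(c) • f n`, with `V` the Volterra operator `g ↦ ∫₀ᵗ g`, therefore converges for
every continuous `g`, and `T (J g) = J (V g)`. The study of `I ± T` is thus reduced to that of
`1 ± V` acting on the constant function `1`.

The functions `(1 - V)ᵏ 1` are the Laguerre polynomials `Lₖ`. An energy argument for their
differential equation gives `|Lₖ| ≤ 1` and `V Lₖ → 0` on `[0, 1/2]`, whence `(I - T)ᵏ (J 1) → 0`;
replacing `T` by `-T` gives the same for `I + T`. Since multiplication by `e⁻ᵗ` conjugates `1 - V`
into `(1 + V)⁻¹`, the functions `(1 + V)⁻ᵏ 1` satisfy the same bounds, and their images under `J`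
form a backward orbit of `I + T` tending to zero.

The vectors `J 1` span a dense subspace as `c` varies, because `J 1` is a power series in `c` whose
coefficients are multiples of the `f n`. Backward orbits inside `{x | Tᵏ x → 0}` are unique, as
`T x = -x` forces `‖Tᵏ x‖ = ‖x‖`; this yields the map `S`.
-/

section Volterra

/-- The Volterra operator `f ↦ ∫₀ᵗ f` on continuous functions. -/
noncomputable def volterra : C(ℝ, ℝ) →ₗ[ℝ] C(ℝ, ℝ) where
  toFun f := ⟨fun t => ∫ s in (0 : ℝ)..t, f s,
    intervalIntegral.continuous_primitive (fun a b => f.continuous.intervalIntegrable a b) 0⟩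
  map_add' f g := by
    ext t
    exact intervalIntegral.integral_add (f.continuous.intervalIntegrable _ _)
      (g.continuous.intervalIntegrable _ _)
  map_smul' r f := by
    ext t
    exact intervalIntegral.integral_const_mul r f

theorem volterra_apply (f : C(ℝ, ℝ)) (t : ℝ) : volterra f t = ∫ s in (0 : ℝ)..t, f s := rfl

theorem volterra_apply_zero (f : C(ℝ, ℝ)) : volterra f 0 = 0 := by simp [volterra_apply]

theorem hasDerivAt_volterra (f : C(ℝ, ℝ)) (t : ℝ) : HasDerivAt (volterra f) (f t) t :=
  intervalIntegral.integral_hasDerivAt_right (f.continuous.intervalIntegrable _ _)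
    f.continuous.stronglyMeasurable.stronglyMeasurableAtFilter f.continuous.continuousAt

theorem volterra_eq_of_hasDerivAt {f F : C(ℝ, ℝ)} (hF : ∀ t, HasDerivAt F (f t) t)
    (hF0 : F 0 = 0) : volterra f = F := by
  ext t
  rw [volterra_apply, intervalIntegral.integral_eq_sub_of_hasDerivAt (fun s _ => hF s)
    (f.continuous.intervalIntegrable _ _), hF0, sub_zero]

theorem volterra_one : volterra 1 = ContinuousMap.id ℝ :=
  volterra_eq_of_hasDerivAt hasDerivAt_id rfl

theorem volterra_pow_one_apply (n : ℕ) (t : ℝ) : (volterra ^ n) 1 t = t ^ n / n.factorial := by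
  induction n generalizing t with
  | zero => simp
  | succ n ih =>
    rw [pow_succ', Module.End.mul_apply, volterra_apply]
    simp only [ih]
    rw [intervalIntegral.integral_div, integral_pow, zero_pow n.succ_ne_zero, sub_zero, div_div,
      Nat.factorial_succ, Nat.cast_mul, Nat.cast_succ]

theorem id_mul_volterra (f : C(ℝ, ℝ)) :
    ContinuousMap.id ℝ * volterra f =
      volterra (ContinuousMap.id ℝ * f) + volterra (volterra f) := by
  rw [← map_add]
  refine (volterra_eq_of_hasDerivAt (fun t => ?_) (zero_mul _)).symm
  refine ((hasDerivAt_id t).mul (hasDerivAt_volterra f t)).congr_deriv ?_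
  simp [add_comm]

variable {d : ℝ}

theorem abs_volterra_le {f g : C(ℝ, ℝ)} (hfg : ∀ t ∈ Set.Icc 0 d, |f t| ≤ g t) :
    ∀ t ∈ Set.Icc 0 d, |volterra f t| ≤ volterra g t := fun t ht => by
  rw [volterra_apply, volterra_apply, ← Real.norm_eq_abs]
  exact intervalIntegral.norm_integral_le_of_norm_le ht.1
    (Eventually.of_forall fun s hs => hfg s ⟨hs.1.le, hs.2.trans ht.2⟩)
    (g.continuous.intervalIntegrable _ _)

theorem abs_volterra_pow_le {f g : C(ℝ, ℝ)} (hfg : ∀ t ∈ Set.Icc 0 d, |f t| ≤ g t) (n : ℕ) :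
    ∀ t ∈ Set.Icc 0 d, |(volterra ^ n) f t| ≤ (volterra ^ n) g t := by
  induction n with
  | zero => simpa using hfg
  | succ n ih => simpa only [pow_succ', Module.End.mul_apply] using abs_volterra_le ih

theorem abs_volterra_pow_le_pow_div_factorial {f : C(ℝ, ℝ)} {M : ℝ}
    (hf : ∀ t ∈ Set.Icc 0 d, |f t| ≤ M) (n : ℕ) :
    ∀ t ∈ Set.Icc 0 d, |(volterra ^ n) f t| ≤ M * (t ^ n / n.factorial) := fun t ht => by
  simpa [volterra_pow_one_apply] using
    abs_volterra_pow_le (g := M • (1 : C(ℝ, ℝ))) (by simpa using hf) n t ht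

variable {u : ℕ → C(ℝ, ℝ)} {M : ℝ}

theorem tendsto_volterra (hu : ∀ k, ∀ t ∈ Set.Icc 0 d, |u k t| ≤ M)
    (hlim : ∀ t ∈ Set.Icc 0 d, Tendsto (fun k => u k t) atTop (𝓝 0)) :
    ∀ t ∈ Set.Icc 0 d, Tendsto (fun k => volterra (u k) t) atTop (𝓝 0) := fun t ht => by
  have hsub : Set.uIoc 0 t ⊆ Set.Icc 0 d := fun s hs => by
    rw [Set.uIoc_of_le ht.1] at hs
    exact ⟨hs.1.le, hs.2.trans ht.2⟩
  simpa only [volterra_apply, intervalIntegral.integral_zero] using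
    intervalIntegral.tendsto_integral_filter_of_dominated_convergence (fun _ => M)
      (Eventually.of_forall fun k => (u k).continuous.aestronglyMeasurable)
      (Eventually.of_forall fun k => Eventually.of_forall fun s hs => hu k s (hsub hs))
      intervalIntegrable_const (Eventually.of_forall fun s hs => hlim s (hsub hs))

theorem tendsto_volterra_pow_succ (hu : ∀ k, ∀ t ∈ Set.Icc 0 d, |u k t| ≤ M)
    (hlim : ∀ t ∈ Set.Icc 0 d, Tendsto (fun k => volterra (u k) t) atTop (𝓝 0)) (n : ℕ) :
    ∀ t ∈ Set.Icc 0 d, Tendsto (fun k => (volterra ^ (n + 1)) (u k) t) atTop (𝓝 0) := by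
  induction n with
  | zero => simpa using hlim
  | succ n ih =>
    simp only [pow_succ' _ (n + 1), Module.End.mul_apply]
    refine tendsto_volterra (M := M * (d ^ (n + 1) / (n + 1).factorial)) (fun k t ht => ?_) ih
    have hM : 0 ≤ M := (abs_nonneg _).trans (hu k t ht)
    have ht0 : 0 ≤ t := ht.1
    refine (abs_volterra_pow_le_pow_div_factorial (hu k) (n + 1) t ht).trans ?_
    gcongr
    exact ht.2

end Volterra

section Laguerre

/-- The Laguerre polynomials, as the orbit of `1` under `1 - V` with `V` the Volterra operator. -/
noncomputable def laguerre (k : ℕ) : C(ℝ, ℝ) := ((1 - volterra) ^ k) 1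

/-- The sum of `laguerre j` over `j < k`, which is minus the derivative of `laguerre k`. -/
noncomputable def laguerreSum (k : ℕ) : C(ℝ, ℝ) := ∑ j ∈ Finset.range k, laguerre j

theorem laguerre_zero : laguerre 0 = 1 := rfl

theorem laguerre_succ (k : ℕ) : laguerre (k + 1) = laguerre k - volterra (laguerre k) := by
  simp [laguerre, pow_succ']

theorem volterra_laguerre (k : ℕ) : volterra (laguerre k) = laguerre k - laguerre (k + 1) := by
  rw [laguerre_succ, sub_sub_cancel]

theorem laguerreSum_succ (k : ℕ) : laguerreSum (k + 1) = laguerreSum k + laguerre k :=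
  Finset.sum_range_succ laguerre k

theorem volterra_laguerreSum (k : ℕ) : volterra (laguerreSum k) = 1 - laguerre k := by
  simp only [laguerreSum, map_sum, volterra_laguerre, Finset.sum_range_sub', laguerre_zero]

theorem laguerre_eq_one_sub_volterra (k : ℕ) : laguerre k = 1 - volterra (laguerreSum k) := by
  rw [volterra_laguerreSum, sub_sub_cancel]

theorem laguerre_apply_zero (k : ℕ) : laguerre k 0 = 1 := by
  simp [laguerre_eq_one_sub_volterra, volterra_apply_zero]

theorem hasDerivAt_laguerre (k : ℕ) (t : ℝ) :
    HasDerivAt (laguerre k) (-laguerreSum k t) t := by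
  rw [laguerre_eq_one_sub_volterra]
  exact (hasDerivAt_volterra (laguerreSum k) t).const_sub 1

theorem differentiable_laguerreSum (k : ℕ) : Differentiable ℝ (laguerreSum k) := by
  simp only [laguerreSum, ContinuousMap.coe_sum]
  exact Differentiable.sum fun j _ t => (hasDerivAt_laguerre j t).differentiableAt

theorem id_mul_laguerreSum_succ (k : ℕ) :
    ContinuousMap.id ℝ * laguerreSum (k + 1) = (k + 1 : ℝ) • volterra (laguerre k) := by
  induction k with
  | zero => simp [laguerreSum, laguerre_zero, volterra_one]
  | succ k ih =>
    have hrec : laguerreSum (k + 2) =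
        1 + (laguerreSum (k + 1) - volterra (laguerreSum (k + 1))) := by
      rw [volterra_laguerreSum, laguerreSum_succ (k + 1)]
      abel
    have hcomm := id_mul_volterra (laguerreSum (k + 1))
    rw [ih, volterra_laguerreSum, map_sub, volterra_one] at hcomm
    rw [hrec, mul_add, mul_sub, ih, volterra_laguerreSum, hcomm, laguerre_succ]
    simp only [map_sub, map_smul, mul_one]
    push_cast
    module

theorem mul_laguerreSum_succ_apply (k : ℕ) (t : ℝ) :
    t * laguerreSum (k + 1) t = (k + 1) * volterra (laguerre k) t :=
  DFunLike.congr_fun (id_mul_laguerreSum_succ k) t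

/-- An energy functional for the Laguerre differential equation: it dominates `(k + 1) L²` with
`L = laguerre (k + 1)`, and its derivative is `-(1 - 2 t) (L')²`. -/
noncomputable def laguerreEnergy (k : ℕ) (t : ℝ) : ℝ :=
  (k + 1) * laguerre (k + 1) t ^ 2 + t * laguerreSum (k + 1) t ^ 2

theorem laguerreEnergy_zero (k : ℕ) : laguerreEnergy k 0 = k + 1 := by
  simp [laguerreEnergy, laguerre_apply_zero]

theorem hasDerivAt_laguerreEnergy (k : ℕ) (t : ℝ) :
    HasDerivAt (laguerreEnergy k) (-(1 - 2 * t) * laguerreSum (k + 1) t ^ 2) t := by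
  have hL := hasDerivAt_laguerre (k + 1) t
  have hS := (differentiable_laguerreSum (k + 1) t).hasDerivAt
  have hode : laguerreSum (k + 1) t + t * deriv (laguerreSum (k + 1)) t =
      (k + 1) * laguerre k t := by
    have hleft := (hasDerivAt_id t).mul hS
    have hright := (hasDerivAt_volterra (laguerre k) t).const_mul ((k : ℝ) + 1)
    simpa using hleft.unique (hright.congr_of_eventuallyEq
      (Eventually.of_forall (mul_laguerreSum_succ_apply k)))
  have hmul := mul_laguerreSum_succ_apply k t
  rw [volterra_laguerre, ContinuousMap.sub_apply] at hmul
  refine (((hL.pow 2).const_mul ((k : ℝ) + 1)).add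
    ((hasDerivAt_id t).mul (hS.pow 2))).congr_deriv ?_
  simp only [Nat.cast_ofNat, Nat.add_one_sub_one, pow_one, mul_neg, Pi.pow_apply, one_mul, id_eq,
    neg_sub]
  linear_combination 2 * laguerreSum (k + 1) t * (hode - hmul)

theorem laguerreEnergy_le (k : ℕ) {t : ℝ} (ht : t ∈ Set.Icc (0 : ℝ) (1 / 2)) :
    laguerreEnergy k t ≤ k + 1 := by
  have hanti : AntitoneOn (laguerreEnergy k) (Set.Icc 0 (1 / 2)) := by
    refine antitoneOn_of_deriv_nonpos (convex_Icc _ _)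
      (fun s _ => (hasDerivAt_laguerreEnergy k s).continuousAt.continuousWithinAt)
      (fun s _ => (hasDerivAt_laguerreEnergy k s).differentiableAt.differentiableWithinAt)
      fun s hs => ?_
    rw [interior_Icc] at hs
    rw [(hasDerivAt_laguerreEnergy k s).deriv]
    exact mul_nonpos_of_nonpos_of_nonneg (by linarith [hs.2]) (sq_nonneg _)
  exact (hanti (Set.left_mem_Icc.2 (by norm_num)) ht ht.1).trans_eq (laguerreEnergy_zero k)

theorem abs_laguerre_le_one (k : ℕ) {t : ℝ} (ht : t ∈ Set.Icc (0 : ℝ) (1 / 2)) :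
    |laguerre k t| ≤ 1 := by
  cases k with
  | zero => simp [laguerre_zero]
  | succ k =>
    have hsum : 0 ≤ t * laguerreSum (k + 1) t ^ 2 := mul_nonneg ht.1 (sq_nonneg _)
    have hle : ((k : ℝ) + 1) * laguerre (k + 1) t ^ 2 ≤ ((k : ℝ) + 1) * 1 := by
      have henergy := laguerreEnergy_le k ht
      rw [laguerreEnergy] at henergy
      linarith
    exact (sq_le_one_iff_abs_le_one _).1 (le_of_mul_le_mul_left hle (by positivity))

theorem sq_volterra_laguerre_le (k : ℕ) {t : ℝ} (ht : t ∈ Set.Icc (0 : ℝ) (1 / 2)) :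
    volterra (laguerre k) t ^ 2 ≤ 1 / ((k : ℝ) + 1) := by
  have hk : (0 : ℝ) < k + 1 := by positivity
  have hsum : t * laguerreSum (k + 1) t ^ 2 ≤ k + 1 := by
    have henergy := laguerreEnergy_le k ht
    rw [laguerreEnergy] at henergy
    have : 0 ≤ ((k : ℝ) + 1) * laguerre (k + 1) t ^ 2 := by positivity
    linarith
  rw [le_div_iff₀ hk]
  refine le_of_mul_le_mul_left ?_ hk
  calc ((k : ℝ) + 1) * (volterra (laguerre k) t ^ 2 * (k + 1))
      = ((k + 1) * volterra (laguerre k) t) ^ 2 := by ring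
    _ = t * (t * laguerreSum (k + 1) t ^ 2) := by rw [← mul_laguerreSum_succ_apply]; ring
    _ ≤ 1 * (k + 1) :=
      mul_le_mul (by linarith [ht.2]) hsum (mul_nonneg ht.1 (sq_nonneg _)) zero_le_one
    _ = (k + 1) * 1 := mul_comm _ _

theorem tendsto_volterra_laguerre {t : ℝ} (ht : t ∈ Set.Icc (0 : ℝ) (1 / 2)) :
    Tendsto (fun k => volterra (laguerre k) t) atTop (𝓝 0) := by
  have hsq : Tendsto (fun k => volterra (laguerre k) t ^ 2) atTop (𝓝 0) :=
    squeeze_zero (fun _ => sq_nonneg _) (fun k => sq_volterra_laguerre_le k ht)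
      tendsto_one_div_add_atTop_nhds_zero_nat
  rw [tendsto_zero_iff_abs_tendsto_zero]
  simpa [Real.sqrt_sq_eq_abs, Function.comp_def] using hsq.sqrt

end Laguerre

section ExpLaguerre

/-- The function `t ↦ e⁻ᵗ`; multiplication by it conjugates `1 - V` into `(1 + V)⁻¹`. -/
noncomputable def expNeg : C(ℝ, ℝ) := ⟨fun t => Real.exp (-t), by fun_prop⟩

/-- The functions `(1 + V)⁻ᵏ 1`, with `V` the Volterra operator. -/
noncomputable def expLaguerre : ℕ → C(ℝ, ℝ)
  | 0 => 1
  | k + 1 => expNeg * laguerre k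

theorem hasDerivAt_expNeg (t : ℝ) : HasDerivAt expNeg (-expNeg t) t := by
  simpa [expNeg] using (hasDerivAt_neg t).exp

theorem volterra_expNeg : volterra expNeg = 1 - expNeg :=
  volterra_eq_of_hasDerivAt
    (fun t => ((hasDerivAt_expNeg t).const_sub 1).congr_deriv (neg_neg _)) (by simp [expNeg])

theorem volterra_expNeg_mul_sub_volterra (f : C(ℝ, ℝ)) :
    volterra (expNeg * (f - volterra f)) = expNeg * volterra f := by
  refine volterra_eq_of_hasDerivAt (fun t => ?_) (by simp [volterra_apply_zero])
  refine ((hasDerivAt_expNeg t).mul (hasDerivAt_volterra f t)).congr_deriv ?_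
  simp only [ContinuousMap.mul_apply, ContinuousMap.sub_apply]
  ring

theorem volterra_expLaguerre_add_two (k : ℕ) :
    volterra (expLaguerre (k + 2)) = expNeg * volterra (laguerre k) := by
  rw [expLaguerre, laguerre_succ, volterra_expNeg_mul_sub_volterra]

theorem volterra_expLaguerre_succ (k : ℕ) :
    volterra (expLaguerre (k + 1)) = expLaguerre k - expLaguerre (k + 1) := by
  cases k with
  | zero => simp [expLaguerre, laguerre_zero, volterra_expNeg]
  | succ k =>
    rw [volterra_expLaguerre_add_two, volterra_laguerre, mul_sub, expLaguerre, expLaguerre]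

theorem abs_expLaguerre_le_one (k : ℕ) {t : ℝ} (ht : t ∈ Set.Icc (0 : ℝ) (1 / 2)) :
    |expLaguerre k t| ≤ 1 := by
  cases k with
  | zero => simp [expLaguerre]
  | succ k =>
    rw [expLaguerre, ContinuousMap.mul_apply, abs_mul]
    refine mul_le_one₀ ?_ (abs_nonneg _) (abs_laguerre_le_one k ht)
    simpa [expNeg] using ht.1

theorem tendsto_volterra_expLaguerre {t : ℝ} (ht : t ∈ Set.Icc (0 : ℝ) (1 / 2)) :
    Tendsto (fun k => volterra (expLaguerre k) t) atTop (𝓝 0) := by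
  rw [← tendsto_add_atTop_iff_nat 2]
  simpa only [volterra_expLaguerre_add_two, ContinuousMap.mul_apply, mul_zero] using
    (tendsto_volterra_laguerre ht).const_mul (expNeg t)

end ExpLaguerre

section PowerSeries

variable {𝕜 X : Type*} [NontriviallyNormedField 𝕜] [NormedAddCommGroup X] [NormedSpace 𝕜 X]

theorem coeff_mem_of_frequently_mem {p : FormalMultilinearSeries 𝕜 𝕜 X} {F : 𝕜 → X} {z₀ : 𝕜}
    (hF : HasFPowerSeriesAt F p z₀) {W : Submodule 𝕜 X} (hW : IsClosed (W : Set X))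
    (hmem : ∃ᶠ z in 𝓝[≠] z₀, F z ∈ W) (n : ℕ) : p.coeff n ∈ W := by
  have hquot : HasFPowerSeriesAt (W.mkQL ∘ F) (W.mkQL.compFormalMultilinearSeries p) z₀ :=
    hF.imp fun _ hr => W.mkQL.comp_hasFPowerSeriesOnBall hr
  have hzero : ∃ᶠ z in 𝓝[≠] z₀, (W.mkQL ∘ F) z = 0 :=
    hmem.mono fun z hz => (Submodule.Quotient.mk_eq_zero W).2 hz
  have hseries := hquot.eq_zero_of_eventually
    (hquot.analyticAt.frequently_zero_iff_eventually_zero.1 hzero)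
  exact (Submodule.Quotient.mk_eq_zero W).1 (DFunLike.congr_fun (congrFun hseries n) 1)

theorem mem_of_frequently_tsum_pow_smul_mem [CompleteSpace X] {b : ℕ → X} {δ K : ℝ} (hδ : 0 < δ)
    (hb : ∀ n, ‖b n‖ * δ ^ n ≤ K) {W : Submodule 𝕜 X} (hW : IsClosed (W : Set X))
    (hmem : ∃ᶠ z in 𝓝[≠] (0 : 𝕜), ∑' n, z ^ n • b n ∈ W) (n : ℕ) : b n ∈ W := by
  let p : FormalMultilinearSeries 𝕜 𝕜 X := fun n =>
    ContinuousMultilinearMap.mkPiRing 𝕜 (Fin n) (b n)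
  have hcoeff : ∀ n, p.coeff n = b n := fun n => by simp [p, FormalMultilinearSeries.coeff]
  have hradius : 0 < p.radius := by
    refine (ENNReal.coe_pos.2 (Real.toNNReal_pos.2 hδ)).trans_le
      (p.le_radius_of_bound K fun n => ?_)
    rw [p.norm_apply_eq_norm_coef, hcoeff, Real.coe_toNNReal _ hδ.le]
    exact hb n
  have hsum : ∀ z, p.sum z = ∑' n, z ^ n • b n := fun z =>
    tsum_congr fun n => by rw [p.apply_eq_pow_smul_coeff, hcoeff]
  rw [← hcoeff]
  exact coeff_mem_of_frequently_mem (p.hasFPowerSeriesOnBall hradius).hasFPowerSeriesAt hW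
    (by simpa only [hsum] using hmem) n

end PowerSeries

section Orbits

variable {𝕜 X : Type*} [NormedField 𝕜] [NormedAddCommGroup X] [NormedSpace 𝕜 X]

/-- The vectors whose orbit under `A` tends to zero. -/
def vanishingOrbits (A : X →L[𝕜] X) : Submodule 𝕜 X where
  carrier := {x | Tendsto (fun k : ℕ => (A ^ k) x) atTop (𝓝 0)}
  add_mem' hx hy := by simpa using Tendsto.add hx hy
  zero_mem' := by simp
  smul_mem' r x hx := by
    simpa only [Set.mem_ofPred_eq, map_smul, smul_zero] using Tendsto.const_smul hx r

/-- The vectors that have a backward orbit under `A` inside the subspace `H` tending to zero. -/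
def vanishingBackwardOrbits (A : X →L[𝕜] X) (H : Submodule 𝕜 X) : Submodule 𝕜 X where
  carrier := {y | ∃ u : ℕ → X, u 0 = y ∧ (∀ k, u k ∈ H) ∧ (∀ k, A (u (k + 1)) = u k) ∧
    Tendsto u atTop (𝓝 0)}
  add_mem' := by
    rintro _ _ ⟨u, rfl, huH, huA, hu⟩ ⟨v, rfl, hvH, hvA, hv⟩
    exact ⟨u + v, rfl, fun k => H.add_mem (huH k) (hvH k), fun k => by simp [huA, hvA],
      by rw [← add_zero (0 : X)]; exact hu.add hv⟩
  zero_mem' := ⟨0, rfl, fun _ => H.zero_mem, fun _ => map_zero A, tendsto_const_nhds⟩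
  smul_mem' := by
    rintro r _ ⟨u, rfl, huH, huA, hu⟩
    exact ⟨r • u, rfl, fun k => H.smul_mem r (huH k), fun k => by simp [huA],
      by rw [← smul_zero r]; exact hu.const_smul r⟩

theorem injOn_id_add_vanishingOrbits (T : X →L[𝕜] X) :
    Set.InjOn (ContinuousLinearMap.id 𝕜 X + T) (vanishingOrbits T) := by
  intro x hx y hy hxy
  have hT : T (x - y) = -(x - y) := by
    have hker : (ContinuousLinearMap.id 𝕜 X + T) (x - y) = 0 := by rw [map_sub, hxy, sub_self]
    exact eq_neg_of_add_eq_zero_right hker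
  have hnorm : ∀ k : ℕ, ‖(T ^ k) (x - y)‖ = ‖x - y‖ := fun k => by
    induction k with
    | zero => simp
    | succ k ih => rw [pow_succ, mul_apply_eq_comp, hT, map_neg, norm_neg, ih]
  have hlim : Tendsto (fun k : ℕ => ‖(T ^ k) (x - y)‖) atTop (𝓝 0) :=
    tendsto_zero_iff_norm_tendsto_zero.1 ((vanishingOrbits T).sub_mem hx hy)
  simp only [hnorm] at hlim
  exact sub_eq_zero.1 (norm_eq_zero.1 (tendsto_nhds_unique tendsto_const_nhds hlim))

-- Injectivity on `H` makes every chosen backward orbit the orbit of a single map `S`.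
theorem kitaiCriterion_of_dense {𝕜 X : Type*} [RCLike 𝕜] [NormedAddCommGroup X]
    [NormedSpace 𝕜 X] {A : X →L[𝕜] X} {H : Submodule 𝕜 X} (hinj : Set.InjOn A H)
    (hE : Dense (vanishingOrbits A : Set X)) (hF : Dense (vanishingBackwardOrbits A H : Set X)) :
    KitaiCriterion A := by
  choose u hu0 huH huA hu using fun y : vanishingBackwardOrbits A H => y.2
  have hmem : ∀ y, u y 1 ∈ vanishingBackwardOrbits A H := fun y =>
    ⟨fun k => u y (k + 1), rfl, fun k => huH y _, fun k => huA y _,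
      (tendsto_add_atTop_iff_nat 1).2 (hu y)⟩
  let S : vanishingBackwardOrbits A H → vanishingBackwardOrbits A H := fun y => ⟨u y 1, hmem y⟩
  have hAS : ∀ y, A (S y : X) = y := fun y => (huA y 0).trans (hu0 y)
  have hiter : ∀ y k, (S^[k] y : X) = u y k := fun y k => by
    induction k with
    | zero => exact (hu0 y).symm
    | succ k ih =>
      rw [Function.iterate_succ_apply']
      exact hinj (huH _ 1) (huH y _) (by rw [hAS, ih, huA])
  exact ⟨_, _, S, hE, hF, hAS, fun y => by simpa only [hiter] using hu y, fun x hx => hx⟩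

end Orbits

theorem span_range_smul_eq {𝕜 X ι : Type*} [DivisionRing 𝕜] [AddCommGroup X] [Module 𝕜 X]
    {a : ι → 𝕜} (ha : ∀ i, a i ≠ 0) (e : ι → X) :
    Submodule.span 𝕜 (Set.range fun i => a i • e i) = Submodule.span 𝕜 (Set.range e) :=
  le_antisymm
    (Submodule.span_le.2 (Set.range_subset_iff.2 fun i =>
      Submodule.smul_mem _ _ (Submodule.subset_span ⟨i, rfl⟩)))
    (Submodule.span_le.2 (Set.range_subset_iff.2 fun i =>
      (Submodule.smul_mem_iff _ (ha i)).1 (Submodule.subset_span ⟨i, rfl⟩)))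

section VolterraSeries

theorem tendsto_ofReal_nhdsGT_zero (𝕜 : Type*) [RCLike 𝕜] :
    Tendsto ((↑) : ℝ → 𝕜) (𝓝[>] 0) (𝓝[≠] 0) :=
  tendsto_nhdsWithin_iff.2
    ⟨(RCLike.continuous_ofReal.tendsto' 0 0 RCLike.ofReal_zero).mono_left nhdsWithin_le_nhds,
      eventually_mem_nhdsWithin.mono fun _ hc => RCLike.ofReal_ne_zero.2 (ne_of_gt hc)⟩

variable {𝕜 X : Type*} [RCLike 𝕜] [NormedAddCommGroup X] [NormedSpace 𝕜 X] {f : ℕ → X}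
  {δ K c M : ℝ} {g : C(ℝ, ℝ)}

variable (𝕜) in
/-- The series `J g = ∑ (Vⁿ⁺¹ g)(c) • f n`, with `V` the Volterra operator. It turns `V` into a
backward shift along `f`: if `T (f 0) = 0` and `T (f (n + 1)) = f n`, then `T (J g) = J (V g)`. -/
noncomputable def volterraSeries (f : ℕ → X) (c : ℝ) (g : C(ℝ, ℝ)) : X :=
  ∑' n, (((volterra ^ (n + 1)) g c : ℝ) : 𝕜) • f n

theorem volterraSeries_one (f : ℕ → X) (c : ℝ) :
    volterraSeries 𝕜 f c 1 = (c : 𝕜) • ∑' n, (c : 𝕜) ^ n • ((n + 1).factorial : 𝕜)⁻¹ • f n := by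
  rw [← tsum_const_smul'']
  refine tsum_congr fun n => ?_
  rw [volterra_pow_one_apply, smul_smul, smul_smul]
  congr 1
  push_cast
  ring

theorem norm_volterra_pow_succ_smul_le (hf : ∀ n, ‖f n‖ * δ ^ n ≤ K * n.factorial)
    (hc : c ∈ Set.Icc 0 (δ / 2)) (hg : ∀ t ∈ Set.Icc 0 c, |g t| ≤ M) (n : ℕ) :
    ‖(((volterra ^ (n + 1)) g c : ℝ) : 𝕜) • f n‖ ≤ M * K * c * (1 / 2) ^ n := by
  have hc0 : 0 ≤ c := hc.1
  have hcc : c ∈ Set.Icc 0 c := Set.right_mem_Icc.2 hc0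
  have hM : 0 ≤ M := (abs_nonneg _).trans (hg c hcc)
  have hpow : c ^ (n + 1) / (n + 1).factorial ≤ (δ / 2) ^ n * c / n.factorial := by
    rw [pow_succ]
    gcongr
    · exact mul_nonneg (pow_nonneg (hc0.trans hc.2) n) hc0
    · exact hc.2
    · exact n.le_succ
  rw [norm_smul, RCLike.norm_ofReal]
  calc |(volterra ^ (n + 1)) g c| * ‖f n‖
      ≤ M * ((δ / 2) ^ n * c / n.factorial) * ‖f n‖ := by
        gcongr
        exact (abs_volterra_pow_le_pow_div_factorial hg (n + 1) c hcc).trans (by gcongr)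
    _ = M * c * (1 / 2) ^ n * (‖f n‖ * δ ^ n / n.factorial) := by
        rw [div_pow, div_pow, one_pow]
        ring
    _ ≤ M * c * (1 / 2) ^ n * K := by
        gcongr
        exact (div_le_iff₀ (by positivity)).2 (hf n)
    _ = M * K * c * (1 / 2) ^ n := by ring

theorem norm_volterraSeries_le (hf : ∀ n, ‖f n‖ * δ ^ n ≤ K * n.factorial)
    (hc : c ∈ Set.Icc 0 (δ / 2)) (hg : ∀ t ∈ Set.Icc 0 c, |g t| ≤ M) :
    ‖volterraSeries 𝕜 f c g‖ ≤ M * K * c * 2 :=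
  tsum_of_norm_bounded (hasSum_geometric_two.mul_left _) (norm_volterra_pow_succ_smul_le hf hc hg)

variable [CompleteSpace X]

theorem summable_volterra_pow_succ_smul (hf : ∀ n, ‖f n‖ * δ ^ n ≤ K * n.factorial)
    (hc : c ∈ Set.Icc 0 (δ / 2)) (g : C(ℝ, ℝ)) :
    Summable fun n => (((volterra ^ (n + 1)) g c : ℝ) : 𝕜) • f n := by
  obtain ⟨M, hM⟩ := isCompact_Icc.exists_bound_of_continuousOn (s := Set.Icc 0 c)
    g.continuous.continuousOn
  exact .of_norm_bounded (summable_geometric_two.mul_left _)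
    (norm_volterra_pow_succ_smul_le hf hc hM)

theorem volterraSeries_sub (hf : ∀ n, ‖f n‖ * δ ^ n ≤ K * n.factorial)
    (hc : c ∈ Set.Icc 0 (δ / 2)) (g h : C(ℝ, ℝ)) :
    volterraSeries 𝕜 f c (g - h) = volterraSeries 𝕜 f c g - volterraSeries 𝕜 f c h := by
  rw [volterraSeries, volterraSeries, volterraSeries,
    ← (summable_volterra_pow_succ_smul hf hc g).tsum_sub (summable_volterra_pow_succ_smul hf hc h)]
  simp only [map_sub, ContinuousMap.sub_apply, sub_smul]

theorem tendsto_volterraSeries (hf : ∀ n, ‖f n‖ * δ ^ n ≤ K * n.factorial)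
    (hc : c ∈ Set.Icc 0 (δ / 2)) {u : ℕ → C(ℝ, ℝ)} (hu : ∀ k, ∀ t ∈ Set.Icc 0 c, |u k t| ≤ M)
    (hlim : ∀ t ∈ Set.Icc 0 c, Tendsto (fun k => volterra (u k) t) atTop (𝓝 0)) :
    Tendsto (fun k => volterraSeries 𝕜 f c (u k)) atTop (𝓝 0) := by
  have hterm (n : ℕ) :
      Tendsto (fun k => (((volterra ^ (n + 1)) (u k) c : ℝ) : 𝕜) • f n) atTop (𝓝 0) := by
    have hcoeff := tendsto_volterra_pow_succ hu hlim n c (Set.right_mem_Icc.2 hc.1)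
    simpa using ((RCLike.continuous_ofReal (K := 𝕜)).tendsto 0 |>.comp hcoeff).smul_const (f n)
  simpa only [volterraSeries, tsum_zero] using tendsto_tsum_of_dominated_convergence
    (summable_geometric_two.mul_left _) hterm
    (Eventually.of_forall fun k => norm_volterra_pow_succ_smul_le hf hc (hu k))

theorem dense_of_frequently_volterraSeries_one_mem (hδ : 0 < δ)
    (hf : ∀ n, ‖f n‖ * δ ^ n ≤ K * n.factorial)
    (hspan : Dense (Submodule.span 𝕜 (Set.range f) : Set X)) {W : Submodule 𝕜 X}
    (hW : ∃ᶠ c in 𝓝[>] (0 : ℝ), volterraSeries 𝕜 f c 1 ∈ W) : Dense (W : Set X) := by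
  have hbound : ∀ n, ‖((n + 1).factorial : 𝕜)⁻¹ • f n‖ * δ ^ n ≤ K := fun n => by
    have hK : 0 ≤ K := (norm_nonneg (f 0)).trans (by simpa using hf 0)
    have hfact : (n.factorial : ℝ) ≤ (n + 1).factorial := mod_cast Nat.factorial_le n.le_succ
    rw [norm_smul, norm_inv, RCLike.norm_natCast, mul_assoc, inv_mul_le_iff₀ (by positivity),
      mul_comm _ K]
    exact (hf n).trans (mul_le_mul_of_nonneg_left hfact hK)
  have hmem : ∃ᶠ z in 𝓝[≠] (0 : 𝕜),
      ∑' n, z ^ n • ((n + 1).factorial : 𝕜)⁻¹ • f n ∈ W.topologicalClosure := by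
    refine (tendsto_ofReal_nhdsGT_zero 𝕜).frequently
      ((hW.and_eventually self_mem_nhdsWithin).mono fun c hc => W.le_topologicalClosure ?_)
    rw [volterraSeries_one] at hc
    exact (W.smul_mem_iff (RCLike.ofReal_ne_zero.2 (ne_of_gt hc.2))).1 hc.1
  have hfW : ∀ n, f n ∈ W.topologicalClosure := fun n =>
    (Submodule.smul_mem_iff _ (inv_ne_zero (Nat.cast_ne_zero.2 (n + 1).factorial_ne_zero))).1
      (mem_of_frequently_tsum_pow_smul_mem hδ hbound W.isClosed_topologicalClosure hmem n)
  exact dense_closure.1 (hspan.mono (Submodule.span_le.2 (Set.range_subset_iff.2 hfW)))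

end VolterraSeries

section FactorialChain

variable {𝕜 X : Type*} [RCLike 𝕜] [NormedAddCommGroup X] [NormedSpace 𝕜 X] {T : X →L[𝕜] X}
  {f : ℕ → X} {δ K c : ℝ}

/-- `f` is a backward orbit of `T` starting in the kernel of `T` whose norms grow at most like
`n! / δⁿ`. -/
structure IsFactorialChain (T : X →L[𝕜] X) (f : ℕ → X) (δ K : ℝ) : Prop where
  rate_pos : 0 < δ
  map_zero : T (f 0) = 0
  map_succ : ∀ n, T (f (n + 1)) = f n
  norm_mul_pow_le : ∀ n, ‖f n‖ * δ ^ n ≤ K * n.factorial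

namespace IsFactorialChain

theorem neg (hf : IsFactorialChain T f δ K) :
    IsFactorialChain (-T) (fun n => (-1 : 𝕜) ^ n • f n) δ K where
  rate_pos := hf.rate_pos
  map_zero := by simp [hf.map_zero]
  map_succ n := by simp [hf.map_succ, pow_succ]
  norm_mul_pow_le n := by simpa [norm_smul] using hf.norm_mul_pow_le n

variable [CompleteSpace X]

theorem map_volterraSeries (hf : IsFactorialChain T f δ K) (hc : c ∈ Set.Icc 0 (δ / 2))
    (g : C(ℝ, ℝ)) : T (volterraSeries 𝕜 f c g) = volterraSeries 𝕜 f c (volterra g) := by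
  have hsum := summable_volterra_pow_succ_smul (𝕜 := 𝕜) hf.norm_mul_pow_le hc g
  rw [volterraSeries, T.map_tsum hsum, (T.summable hsum).tsum_eq_zero_add, map_smul, hf.map_zero,
    smul_zero, zero_add]
  refine tsum_congr fun n => ?_
  rw [map_smul, hf.map_succ, pow_succ, Module.End.mul_apply]

theorem pow_apply_volterraSeries (hf : IsFactorialChain T f δ K) (hc : c ∈ Set.Icc 0 (δ / 2))
    (g : C(ℝ, ℝ)) (k : ℕ) :
    (T ^ k) (volterraSeries 𝕜 f c g) = volterraSeries 𝕜 f c ((volterra ^ k) g) := by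
  induction k with
  | zero => rfl
  | succ k ih =>
    rw [pow_succ', mul_apply_eq_comp, ih,
      hf.map_volterraSeries hc, pow_succ', Module.End.mul_apply]

theorem volterraSeries_mem_vanishingOrbits (hf : IsFactorialChain T f δ K)
    (hc : c ∈ Set.Icc 0 (δ / 2)) (g : C(ℝ, ℝ)) :
    volterraSeries 𝕜 f c g ∈ vanishingOrbits T := by
  obtain ⟨M, hM⟩ := isCompact_Icc.exists_bound_of_continuousOn (s := Set.Icc 0 c)
    g.continuous.continuousOn
  have hM0 : 0 ≤ M := (norm_nonneg _).trans (hM c (Set.right_mem_Icc.2 hc.1))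
  have hpow : ∀ k : ℕ, ∀ t ∈ Set.Icc 0 c,
      |(volterra ^ k) g t| ≤ M * (c ^ k / k.factorial) := fun k t ht => by
    have ht0 : 0 ≤ t := ht.1
    refine (abs_volterra_pow_le_pow_div_factorial hM k t ht).trans ?_
    gcongr
    exact ht.2
  have hlim : Tendsto (fun k : ℕ => M * (c ^ k / k.factorial) * K * c * 2) atTop (𝓝 0) := by
    simpa using ((((FloorSemiring.tendsto_pow_div_factorial_atTop c).const_mul M).mul_const
      K).mul_const c).mul_const 2
  refine squeeze_zero_norm (fun k => ?_) hlim
  rw [hf.pow_apply_volterraSeries hc]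
  exact norm_volterraSeries_le hf.norm_mul_pow_le hc (hpow k)

theorem id_sub_pow_apply_volterraSeries_one (hf : IsFactorialChain T f δ K)
    (hc : c ∈ Set.Icc 0 (δ / 2)) (k : ℕ) :
    ((ContinuousLinearMap.id 𝕜 X - T) ^ k) (volterraSeries 𝕜 f c 1) =
      volterraSeries 𝕜 f c (laguerre k) := by
  induction k with
  | zero => rfl
  | succ k ih =>
    rw [pow_succ', mul_apply_eq_comp, ih, sub_apply,
      ContinuousLinearMap.id_apply, hf.map_volterraSeries hc,
      ← volterraSeries_sub hf.norm_mul_pow_le hc, ← laguerre_succ]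

theorem id_add_apply_volterraSeries_expLaguerre_succ (hf : IsFactorialChain T f δ K)
    (hc : c ∈ Set.Icc 0 (δ / 2)) (k : ℕ) :
    (ContinuousLinearMap.id 𝕜 X + T) (volterraSeries 𝕜 f c (expLaguerre (k + 1))) =
      volterraSeries 𝕜 f c (expLaguerre k) := by
  rw [add_apply, ContinuousLinearMap.id_apply, hf.map_volterraSeries hc,
    volterra_expLaguerre_succ, volterraSeries_sub hf.norm_mul_pow_le hc, add_sub_cancel]

theorem dense_vanishingOrbits_id_sub (hf : IsFactorialChain T f δ K)
    (hspan : Dense (Submodule.span 𝕜 (Set.range f) : Set X)) :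
    Dense (vanishingOrbits (ContinuousLinearMap.id 𝕜 X - T) : Set X) := by
  refine dense_of_frequently_volterraSeries_one_mem hf.rate_pos hf.norm_mul_pow_le hspan
    (Eventually.frequently ?_)
  filter_upwards [Icc_mem_nhdsGT (half_pos hf.rate_pos), Icc_mem_nhdsGT one_half_pos] with c hcδ hc
  have hsub : Set.Icc 0 c ⊆ Set.Icc 0 (1 / 2) := Set.Icc_subset_Icc_right hc.2
  exact Tendsto.congr (fun k => (hf.id_sub_pow_apply_volterraSeries_one hcδ k).symm)
    (tendsto_volterraSeries hf.norm_mul_pow_le hcδ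
      (fun k t ht => abs_laguerre_le_one k (hsub ht))
      fun t ht => tendsto_volterra_laguerre (hsub ht))

theorem dense_vanishingBackwardOrbits_id_add (hf : IsFactorialChain T f δ K)
    (hspan : Dense (Submodule.span 𝕜 (Set.range f) : Set X)) :
    Dense (vanishingBackwardOrbits (ContinuousLinearMap.id 𝕜 X + T) (vanishingOrbits T) :
      Set X) := by
  refine dense_of_frequently_volterraSeries_one_mem hf.rate_pos hf.norm_mul_pow_le hspan
    (Eventually.frequently ?_)
  filter_upwards [Icc_mem_nhdsGT (half_pos hf.rate_pos), Icc_mem_nhdsGT one_half_pos] with c hcδ hc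
  have hsub : Set.Icc 0 c ⊆ Set.Icc 0 (1 / 2) := Set.Icc_subset_Icc_right hc.2
  exact ⟨fun k => volterraSeries 𝕜 f c (expLaguerre k), rfl,
    fun k => hf.volterraSeries_mem_vanishingOrbits hcδ _,
    hf.id_add_apply_volterraSeries_expLaguerre_succ hcδ,
    tendsto_volterraSeries hf.norm_mul_pow_le hcδ
      (fun k t ht => abs_expLaguerre_le_one k (hsub ht))
      fun t ht => tendsto_volterra_expLaguerre (hsub ht)⟩

theorem kitaiCriterion_id_add (hf : IsFactorialChain T f δ K)
    (hspan : Dense (Submodule.span 𝕜 (Set.range f) : Set X)) :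
    KitaiCriterion (ContinuousLinearMap.id 𝕜 X + T) := by
  have hspan_neg : Dense (Submodule.span 𝕜 (Set.range fun n => (-1 : 𝕜) ^ n • f n) : Set X) := by
    rwa [span_range_smul_eq fun n => pow_ne_zero n (neg_ne_zero.2 one_ne_zero)]
  refine kitaiCriterion_of_dense (injOn_id_add_vanishingOrbits T) ?_
    (hf.dense_vanishingBackwardOrbits_id_add hspan)
  simpa only [sub_neg_eq_add] using hf.neg.dense_vanishingOrbits_id_sub hspan_neg

end IsFactorialChain

end FactorialChain

section SequenceSpaces

variable (𝕜 : Type*) [RCLike 𝕜]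

theorem norm_lpBasis (p : ℝ≥0∞) [Fact (1 ≤ p)] (n : ℕ) : ‖lpBasis 𝕜 p n‖ = 1 := by
  rw [lpBasis, lp.norm_single (zero_lt_one.trans_le Fact.out), norm_one]

theorem dense_span_lpBasis {p : ℝ≥0∞} [Fact (1 ≤ p)] (hp : p ≠ ∞) :
    Dense (Submodule.span 𝕜 (Set.range (lpBasis 𝕜 p)) : Set (lp (fun _ : ℕ => 𝕜) p)) := by
  intro x
  refine mem_closure_of_tendsto (lp.hasSum_single hp x) (Eventually.of_forall fun s =>
    Submodule.sum_mem _ fun n _ => ?_)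
  have hsingle : lp.single p n (x n) = x n • lpBasis 𝕜 p n := by
    rw [lpBasis, ← lp.single_smul, smul_eq_mul, mul_one]
  rw [hsingle]
  exact Submodule.smul_mem _ _ (Submodule.subset_span ⟨n, rfl⟩)

variable {𝕜}

theorem zeroAtInfty_norm_le {α E : Type*} [TopologicalSpace α] [SeminormedAddCommGroup E]
    {x : C₀(α, E)} {r : ℝ} (hr : 0 ≤ r) (hx : ∀ a, ‖x a‖ ≤ r) : ‖x‖ ≤ r := by
  rw [← ZeroAtInftyContinuousMap.norm_toBCF_eq_norm]
  exact (BoundedContinuousFunction.norm_le hr).2 hx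

theorem c0Basis_apply (n m : ℕ) : c0Basis 𝕜 n m = if m = n then 1 else 0 :=
  Pi.single_apply n 1 m

theorem norm_c0Basis_le (n : ℕ) : ‖c0Basis 𝕜 n‖ ≤ 1 := by
  refine zeroAtInfty_norm_le zero_le_one fun m => ?_
  rw [c0Basis_apply]
  split_ifs <;> simp

theorem sum_smul_c0Basis_apply (x : ℕ → 𝕜) (N m : ℕ) :
    (∑ n ∈ Finset.range N, x n • c0Basis 𝕜 n) m = if m < N then x m else 0 := by
  induction N with
  | zero => rfl
  | succ N ih =>
    rw [Finset.sum_range_succ, ZeroAtInftyContinuousMap.add_apply, ih,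
      ZeroAtInftyContinuousMap.smul_apply, c0Basis_apply, smul_eq_mul]
    grind

variable (𝕜) in
theorem dense_span_c0Basis :
    Dense (Submodule.span 𝕜 (Set.range (c0Basis 𝕜)) : Set C₀(ℕ, 𝕜)) := by
  refine fun x => Metric.mem_closure_iff.2 fun ε hε => ?_
  have hx : Tendsto x atTop (𝓝 0) := by
    simpa only [cocompact_eq_cofinite, Nat.cofinite_eq_atTop] using zero_at_infty x
  obtain ⟨N, hN⟩ := Metric.tendsto_atTop.1 hx (ε / 2) (half_pos hε)
  refine ⟨∑ n ∈ Finset.range N, x n • c0Basis 𝕜 n, Submodule.sum_mem _ fun n _ =>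
    Submodule.smul_mem _ _ (Submodule.subset_span ⟨n, rfl⟩), ?_⟩
  rw [dist_eq_norm]
  refine (zeroAtInfty_norm_le (half_pos hε).le fun n => ?_).trans_lt (half_lt_self hε)
  rw [ZeroAtInftyContinuousMap.sub_apply, sum_smul_c0Basis_apply]
  split_ifs with hn
  · simpa using (half_pos hε).le
  · simpa using (hN n (not_lt.1 hn)).le

end SequenceSpaces

section WeightedShift

theorem exists_inv_mul_pow_le_factorial_of_liminf_pos {a : ℕ → ℝ} (ha : ∀ n, 0 ≤ a n)
    (hlim : 0 < liminf (fun n : ℕ => ENNReal.ofReal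
      (((n.factorial : ℝ) * a n) ^ (1 / (n : ℝ)))) atTop) :
    ∃ δ > 0, ∃ K : ℝ, ∀ n : ℕ, (a n)⁻¹ * δ ^ n ≤ K * n.factorial := by
  obtain ⟨ε, hε0, hε⟩ := exists_between hlim
  have hδ : 0 < ε.toReal := ENNReal.toReal_pos hε0.ne' hε.ne_top
  have hpow : ∀ᶠ n : ℕ in atTop, ε.toReal ^ n ≤ n.factorial * a n := by
    filter_upwards [eventually_lt_of_lt_liminf hε, eventually_ne_atTop 0] with n hn hn0
    have hbase : 0 ≤ (n.factorial : ℝ) * a n := mul_nonneg (Nat.cast_nonneg _) (ha n)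
    have hroot : ε.toReal ≤ ((n.factorial : ℝ) * a n) ^ (1 / (n : ℝ)) :=
      ENNReal.toReal_le_of_le_ofReal (Real.rpow_nonneg hbase _) hn.le
    simpa only [one_div, Real.rpow_inv_natCast_pow hbase hn0] using
      pow_le_pow_left₀ hδ.le hroot n
  have hratio : ∀ᶠ n : ℕ in atTop, (a n)⁻¹ * ε.toReal ^ n / n.factorial ≤ 1 := by
    filter_upwards [hpow] with n hn
    rw [div_le_one (by positivity)]
    exact inv_mul_le_of_le_mul₀ (ha n) (Nat.cast_nonneg _) (by rwa [mul_comm])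
  obtain ⟨K, hK⟩ := (isBoundedUnder_of_eventually_le hratio).bddAbove_range
  exact ⟨ε.toReal, hδ, K, fun n => (div_le_iff₀ (by positivity)).1 (hK ⟨n, rfl⟩)⟩

variable {𝕜 X : Type*} [RCLike 𝕜] [NormedAddCommGroup X] [NormedSpace 𝕜 X]

theorem exists_isFactorialChain_of_isBackwardWeightedShift {e : ℕ → X} {w : ℕ → 𝕜}
    {T : X →L[𝕜] X} (hT : IsBackwardWeightedShift e w T) {B : ℝ} (he : ∀ n, ‖e n‖ ≤ B)
    (hw : 0 < liminf (fun n : ℕ => ENNReal.ofReal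
      (((n.factorial : ℝ) * ∏ j ∈ Finset.Icc 1 n, ‖w j‖) ^ (1 / (n : ℝ)))) atTop) :
    ∃ δ K, IsFactorialChain T (fun n => (∏ j ∈ Finset.Icc 1 n, w j)⁻¹ • e n) δ K := by
  obtain ⟨δ, hδ, K, hK⟩ := exists_inv_mul_pow_le_factorial_of_liminf_pos
    (fun n => Finset.prod_nonneg fun j _ => norm_nonneg (w j)) hw
  refine ⟨δ, B * K, hδ, ?_, fun n => ?_, fun n => ?_⟩
  · rw [map_smul, hT.map_zero, smul_zero]
  · have hn : 1 ≤ n + 1 := n.succ_pos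
    rw [map_smul, hT.map_basis _ hn, smul_smul, Finset.prod_Icc_succ_top hn, mul_inv,
      inv_mul_cancel_right₀ (hT.weight_ne_zero _ hn), Nat.add_sub_cancel]
  · rw [norm_smul, norm_inv, norm_prod]
    calc (∏ j ∈ Finset.Icc 1 n, ‖w j‖)⁻¹ * ‖e n‖ * δ ^ n
        = ‖e n‖ * ((∏ j ∈ Finset.Icc 1 n, ‖w j‖)⁻¹ * δ ^ n) := by ring
      _ ≤ B * (K * n.factorial) :=
        mul_le_mul (he n) (hK n) (by positivity) ((norm_nonneg _).trans (he n))
      _ = B * K * n.factorial := (mul_assoc _ _ _).symm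

theorem theorem2_general [CompleteSpace X] {e : ℕ → X} {w : ℕ → 𝕜} {T : X →L[𝕜] X}
    (hT : IsBackwardWeightedShift e w T) {B : ℝ} (he : ∀ n, ‖e n‖ ≤ B)
    (hspan : Dense (Submodule.span 𝕜 (Set.range e) : Set X))
    (hw : 0 < liminf (fun n : ℕ => ENNReal.ofReal
      (((n.factorial : ℝ) * ∏ j ∈ Finset.Icc 1 n, ‖w j‖) ^ (1 / (n : ℝ)))) atTop) :
    KitaiCriterion (ContinuousLinearMap.id 𝕜 X + T) := by
  obtain ⟨δ, K, hchain⟩ := exists_isFactorialChain_of_isBackwardWeightedShift hT he hw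
  refine hchain.kitaiCriterion_id_add ?_
  rwa [span_range_smul_eq fun n => inv_ne_zero (Finset.prod_ne_zero_iff.2 fun j hj =>
    hT.weight_ne_zero j (Finset.mem_Icc.1 hj).1)]

end WeightedShift

theorem theorem2 {𝕜 : Type*} [RCLike 𝕜] (w : ℕ → 𝕜)
    -- the lower limit is taken in `[0, ∞]`, as it may be infinite
    (hw : 0 < liminf (fun n : ℕ => ENNReal.ofReal
      (((n.factorial : ℝ) * ∏ j ∈ Finset.Icc 1 n, ‖w j‖) ^ (1 / (n : ℝ)))) atTop) :
    (∀ (p : ℝ≥0∞) [Fact (1 ≤ p)], p ≠ ∞ →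
      ∀ T : lp (fun _ : ℕ => 𝕜) p →L[𝕜] lp (fun _ : ℕ => 𝕜) p,
        IsBackwardWeightedShift (lpBasis 𝕜 p) w T →
          KitaiCriterion (ContinuousLinearMap.id 𝕜 (lp (fun _ : ℕ => 𝕜) p) + T)) ∧
    (∀ T : C₀(ℕ, 𝕜) →L[𝕜] C₀(ℕ, 𝕜),
      IsBackwardWeightedShift (c0Basis 𝕜) w T →
        KitaiCriterion (ContinuousLinearMap.id 𝕜 C₀(ℕ, 𝕜) + T)) := by
  exact ⟨fun p _ hp T hT => theorem2_general hT (fun n => (norm_lpBasis 𝕜 p n).le)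
      (dense_span_lpBasis 𝕜 hp) hw,
    fun T hT => theorem2_general hT norm_c0Basis_le (dense_span_c0Basis 𝕜) hw⟩
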